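/- Let $N\ge 0$ and let $m_1,\dots,m_N,n_1,\dots,n_N$ be positive integers. Put \[ A(x)=\prod_{i=1}^N A_i(x),\qquad A_i(x)=1+x^{m_i}+\dots+x^{m_i(n_i-1)}=\frac{x^{m_in_i}-1}{x^{m_i}-1}, \] and let $d_{ij}=\gcd(m_i,m_j)$. Let $\Phi_s$ denote the $s$-th cyclotomic polynomial, and let $S_A$ be the set of prime powers $p^\alpha$ ($p$ prime, $\alpha\ge 1$) such that $\Phi_{p^\alpha}(x)$ divides $A(x)$. Then the following are equivalent: (i) $A(x)$ has coefficients $0,1$, i.e. $A(x)=\sum_{a\in A}x^a$ for a finite set $A\subset\{0,1,2,\dots\}$, and the set $A$ tiles $\mathbf Z$ by translations, i.e. there is a set $B\subset\mathbf Z$ such that every integer can be uniquely represented as $a+b$ with $a\in A$, $b\in B$; (ii) $A(x)$ satisfies both (T1) $A(1)=\prod_{s\in S_A}\Phi_s(1)$, and (T2) if $k\ge 1$ and $s_1,\dots,s_k\in S_A$ are powers of different primes, then $\Phi_{s_1\cdots s_k}(x)$ divides $A(x)$; (iii) the factors $A_1,\dots,A_N$ can be relabelled so that, for each $i=1,\dots,N-1$,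 \[ n_i\ \Big|\ \gcd\Big(\frac{m_{i+1}}{d_{i,i+1}},\dots,\frac{m_N}{d_{i,N}}\Big). \] In particular (equivalence of (i) and (ii)), the Coven--Meyerowitz conjecture holds for all products of this form. -/

import Mathlib

open Polynomial

/-- The polynomial `1 + x^m + x^(2m) + ⋯ + x^(m(n-1)) = (x^(mn) - 1) / (x^m - 1)`. -/
noncomputable def progressionPoly (m n : ℕ) : ℤ[X] :=
  ∑ j ∈ Finset.range n, X ^ (m * j)

/-- The product `∏ i, (x^(mᵢnᵢ) - 1) / (x^(mᵢ) - 1)`. -/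
noncomputable def progressionProd {N : ℕ} (m n : Fin N → ℕ) : ℤ[X] :=
  ∏ i, progressionPoly (m i) (n i)

/-- `A` tiles `ℤ` by translations: there is `B ⊆ ℤ` such that every integer is uniquely
`a + b` with `a ∈ A` and `b ∈ B`. -/
def TilesInt (A : Set ℤ) : Prop :=
  ∃ B : Set ℤ, AddSubgroup.IsComplement A B

/-- Condition (T): `P(x) = ∑_{a ∈ A} x^a` for a finite set `A` of nonnegative integers, and `A`
tiles `ℤ` by translations. -/
def ConditionT (P : ℤ[X]) : Prop :=
  ∃ A : Finset ℕ, P = ∑ a ∈ A, X ^ a ∧ TilesInt ((fun a : ℕ => (a : ℤ)) '' (A : Set ℕ))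

/-- `S_P`: the prime powers `s = p^α` (`α ≥ 1`) such that `Φ_s` divides `P`. -/
def cyclotomicPrimePowers (P : ℤ[X]) : Set ℕ :=
  {s | IsPrimePow s ∧ cyclotomic s ℤ ∣ P}

/-- Condition (T1): `P(1) = ∏_{s ∈ S_P} Φ_s(1)`. (The set `S_P` is finite when `P ≠ 0`.) -/
def ConditionT1 (P : ℤ[X]) : Prop :=
  P.eval 1 = ∏ᶠ s ∈ cyclotomicPrimePowers P, (cyclotomic s ℤ).eval 1

/-- Condition (T2): if `s₁, …, s_k ∈ S_P` (`k ≥ 1`) are powers of different primes, then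
`Φ_{s₁⋯s_k}` divides `P`. Here `F` is the set of primes involved, and `p ^ α p` is the
power of `p` in question. -/
def ConditionT2 (P : ℤ[X]) : Prop :=
  ∀ (F : Finset ℕ) (α : ℕ → ℕ), F.Nonempty → (∀ p ∈ F, p.Prime) →
    (∀ p ∈ F, p ^ α p ∈ cyclotomicPrimePowers P) →
      cyclotomic (∏ p ∈ F, p ^ α p) ℤ ∣ P

/-- The divisibility tower, for the given labelling of the factors:
`nᵢ ∣ gcd (m_{i+1} / d_{i,i+1}, …, m_N / d_{i,N})` for each `i`, where `d_{ij} = gcd (mᵢ, m_j)`.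
For the last index the gcd is over the empty set, hence `0`, and nothing is required. -/
def DivisibilityTower {N : ℕ} (m n : Fin N → ℕ) : Prop :=
  ∀ i : Fin N, n i ∣ (Finset.Ioi i).gcd (fun j => m j / Nat.gcd (m i) (m j))

/-! Let `X` act on functions `ℤ → ℤ` as translation by 1. A tiling by `P` becomes an equation `P β =
1` with `β ≥ 0`. Allowing weights costs nothing, since constant coefficient 1 forces `β ≤ 1`, and it
makes tilings pass to factors: if `P R` tiles with `β` and `R` has nonnegative coefficients, then
`P` tiles with `R β`.

The arithmetic is carried by the layers of a factor, the prime powers `s` with `s ∣ m n` and `¬ s ∣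
m`. (T1) says that distinct factors have disjoint layers, and the tower says that every layer of a
factor divides the `m` of each later factor (`dvd_div_gcd_iff`). So (ii) ⇔ (iii) is combinatorial:
in a tower the last factor involved witnesses (T2), and conversely (T2) applied to the top layer of
each prime singles out a last factor, which can be removed (`LayersCompatible.exists_last`).

For (iii) ⇒ (i) the tiling is built from the last factor to the first, each one filling `dnℤ` up to
`dℤ`. For (i) ⇒ (iii) the key is dilation: in a periodic tiling a factor may be dilated by any
positive integer prime to its size. Hence the steps of factors of prime size satisfy no integer
relation with coefficients prime to the respective sizes (`TilesPeriodically.false_of_relation`). If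
no factor could come first, each factor would supply a relation between two steps, and these would
combine into a forbidden one (`TilesPeriodically.exists_first`). -/

/-! ### Nonnegative polynomials and their action on functions on ℤ -/

/-- The integer polynomials with nonnegative coefficients. -/
def nonnegPoly : Subsemiring ℤ[X] where
  carrier := {P | ∀ a, 0 ≤ P.coeff a}
  mul_mem' := by
    intro P Q hP hQ a
    rw [coeff_mul]
    exact Finset.sum_nonneg fun x _ => mul_nonneg (hP _) (hQ _)
  one_mem' := by
    intro a
    rw [coeff_one]
    split_ifs <;> simp
  add_mem' := by
    intro P Q hP hQ a
    rw [coeff_add]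
    exact add_nonneg (hP a) (hQ a)
  zero_mem' := by
    intro a
    simp

theorem X_pow_mem_nonnegPoly (a : ℕ) : (X ^ a : ℤ[X]) ∈ nonnegPoly := by
  intro b
  rw [coeff_X_pow]
  split_ifs <;> simp

theorem progressionPoly_mem_nonnegPoly (m n : ℕ) : progressionPoly m n ∈ nonnegPoly :=
  Subsemiring.sum_mem _ fun _ _ => X_pow_mem_nonnegPoly _

/-- Translation by `1` on functions `ℤ → ℤ`. -/
def shift : Module.End ℤ (ℤ → ℤ) := LinearMap.funLeft ℤ ℤ fun x => x - 1

theorem shift_pow_apply (a : ℕ) (β : ℤ → ℤ) (x : ℤ) : (shift ^ a) β x = β (x - a) := by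
  induction a generalizing x with
  | zero => simp
  | succ a ih =>
    rw [pow_succ', Module.End.mul_apply]
    change (shift ^ a) β (x - 1) = _
    rw [ih]
    congr 1
    push_cast
    ring

/-- A polynomial acts on functions `ℤ → ℤ`, with `X` acting as the translation by `1`. -/
noncomputable def act (P : ℤ[X]) (β : ℤ → ℤ) : ℤ → ℤ := aeval shift P β

theorem act_mul (P Q : ℤ[X]) (β : ℤ → ℤ) : act (P * Q) β = act P (act Q β) := by
  simp [act]

theorem act_add (P Q : ℤ[X]) (β : ℤ → ℤ) : act (P + Q) β = act P β + act Q β := by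
  simp [act]

theorem act_one (β : ℤ → ℤ) : act 1 β = β := by
  simp [act]

theorem act_sub_right (P : ℤ[X]) (β γ : ℤ → ℤ) : act P (β - γ) = act P β - act P γ := by
  simp [act]

theorem act_C_mul (c : ℤ) (P : ℤ[X]) (β : ℤ → ℤ) : act (C c * P) β = c • act P β := by
  simp [act]

theorem act_X_pow (a : ℕ) (β : ℤ → ℤ) (x : ℤ) : act (X ^ a) β x = β (x - a) := by
  simp [act, shift_pow_apply]

theorem act_sum {ι : Type*} (s : Finset ι) (P : ι → ℤ[X]) (β : ℤ → ℤ) (x : ℤ) :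
    act (∑ i ∈ s, P i) β x = ∑ i ∈ s, act (P i) β x := by
  simp [act]

theorem act_apply (P : ℤ[X]) (β : ℤ → ℤ) (x : ℤ) :
    act P β x = ∑ a ∈ Finset.range (P.natDegree + 1), P.coeff a * β (x - a) := by
  simp [act, aeval_eq_sum_range, shift_pow_apply]

theorem act_progressionPoly (m n : ℕ) (β : ℤ → ℤ) (x : ℤ) :
    act (progressionPoly m n) β x = ∑ j ∈ Finset.range n, β (x - m * j) := by
  simp [progressionPoly, act_sum, act_X_pow]

theorem act_nonneg {P : ℤ[X]} (hP : P ∈ nonnegPoly) {β : ℤ → ℤ} (hβ : 0 ≤ β) :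
    0 ≤ act P β := by
  intro x
  rw [act_apply]
  exact Finset.sum_nonneg fun a _ => mul_nonneg (hP a) (hβ _)

theorem coeff_mul_le_act {P : ℤ[X]} (hP : P ∈ nonnegPoly) {β : ℤ → ℤ} (hβ : 0 ≤ β)
    (a : ℕ) (x : ℤ) : P.coeff a * β (x - a) ≤ act P β x := by
  rw [act_apply]
  by_cases ha : a ∈ Finset.range (P.natDegree + 1)
  · exact Finset.single_le_sum (f := fun a : ℕ => P.coeff a * β (x - a))
      (fun a _ => mul_nonneg (hP a) (hβ _)) ha
  · rw [coeff_eq_zero_of_natDegree_lt (by simpa using ha), zero_mul]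
    exact Finset.sum_nonneg fun a _ => mul_nonneg (hP a) (hβ _)

theorem act_periodic {M : ℤ} {β : ℤ → ℤ} (hβ : Function.Periodic β M) (P : ℤ[X]) :
    Function.Periodic (act P β) M := by
  intro x
  simp only [act_apply]
  refine Finset.sum_congr rfl fun a _ => ?_
  rw [← hβ (x - a)]
  congr 2
  ring

theorem act_one_right (P : ℤ[X]) : act P 1 = fun _ => P.eval 1 := by
  funext x
  simp [act_apply, eval_eq_sum_range]

theorem sum_range_periodic_sub {M : ℕ} {γ : ℤ → ℤ} (hγ : Function.Periodic γ M) (a : ℕ) :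
    ∑ x ∈ Finset.range M, γ ((x : ℤ) - a) = ∑ x ∈ Finset.range M, γ x := by
  induction a with
  | zero => simp
  | succ a ih =>
    rw [← ih]
    cases M with
    | zero => simp
    | succ M =>
      rw [Finset.sum_range_succ', Finset.sum_range_succ]
      congr 1
      · refine Finset.sum_congr rfl fun x _ => ?_
        congr 1
        push_cast
        ring
      · rw [← hγ]
        congr 1
        push_cast
        ring

theorem sum_range_act {M : ℕ} {γ : ℤ → ℤ} (hγ : Function.Periodic γ M) (P : ℤ[X]) :
    ∑ x ∈ Finset.range M, act P γ x = P.eval 1 * ∑ x ∈ Finset.range M, γ x := by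
  simp only [act_apply]
  rw [Finset.sum_comm]
  simp_rw [← Finset.mul_sum, sum_range_periodic_sub hγ]
  rw [← Finset.sum_mul, eval_eq_sum_range]
  simp

/-! ### Weighted tilings and periodicity -/

/-- `P` tiles `ℤ` with some nonnegative multiplicity function as the complement. -/
def TilesWeighted (P : ℤ[X]) : Prop := ∃ β : ℤ → ℤ, 0 ≤ β ∧ act P β = 1

/-- `P` tiles `ℤ` with some periodic nonnegative multiplicity function as the complement. -/
def TilesPeriodically (P : ℤ[X]) : Prop :=
  ∃ (M : ℕ) (β : ℤ → ℤ), 0 < M ∧ Function.Periodic β M ∧ 0 ≤ β ∧ act P β = 1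

theorem TilesPeriodically.of_mul {P R : ℤ[X]} (h : TilesPeriodically (P * R))
    (hR : R ∈ nonnegPoly) : TilesPeriodically P := by
  obtain ⟨M, β, hM, hper, hβ, h⟩ := h
  exact ⟨M, act R β, hM, act_periodic hper R, act_nonneg hR hβ, by rw [← act_mul, h]⟩

theorem le_one_of_act_eq_one {P : ℤ[X]} (hP : P ∈ nonnegPoly) (h0 : P.coeff 0 = 1) {β : ℤ → ℤ}
    (hβ : 0 ≤ β) (h : act P β = 1) (x : ℤ) : β x ≤ 1 := by
  have := coeff_mul_le_act hP hβ 0 x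
  rw [h, h0] at this
  simpa using this

/-- The equation is a linear recurrence of order `P.natDegree` with both end coefficients equal to
1, so it can be solved forwards and backwards from a window of zeros. -/
theorem eq_zero_of_act_eq_zero {P : ℤ[X]} (h0 : P.coeff 0 = 1) (hlead : P.Monic) {δ : ℤ → ℤ}
    (h : act P δ = 0) {t : ℤ} (ht : ∀ y, t ≤ y → y < t + P.natDegree → δ y = 0) : δ = 0 := by
  have forward : ∀ n : ℕ, ∀ y, t ≤ y → y < t + P.natDegree + n → δ y = 0 := by
    intro n
    induction n with
    | zero => simpa using ht
    | succ n ih =>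
      intro y hy hy'
      by_cases hlt : y < t + P.natDegree + n
      · exact ih y hy hlt
      have := congrFun h y
      rw [act_apply, Finset.sum_range_succ'] at this
      rw [Finset.sum_eq_zero] at this
      · simpa [h0] using this
      · intro a ha
        rw [Finset.mem_range] at ha
        rw [ih, mul_zero] <;> push_cast at * <;> omega
  have forward' : ∀ y, t ≤ y → δ y = 0 := fun y hy =>
    forward (y - t + 1).toNat y hy (by omega)
  have backward : ∀ n : ℕ, ∀ y, t - n ≤ y → δ y = 0 := by
    intro n
    induction n with
    | zero => simpa using forward'
    | succ n ih =>
      intro y hy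
      by_cases hlt : t - n ≤ y
      · exact ih y hlt
      have := congrFun h (y + P.natDegree)
      rw [act_apply, Finset.sum_range_succ, Finset.sum_eq_zero] at this
      · simpa [hlead.coeff_natDegree] using this
      · intro a ha
        rw [Finset.mem_range] at ha
        rw [ih, mul_zero]
        push_cast at *
        omega
  funext y
  exact backward (t - y).toNat y (by omega)

/-- The weight takes only the values 0 and 1, so by pigeonhole two windows of length `P.natDegree`
carry the same pattern. The weight minus its translate is annihilated by `P` and vanishes on a
window, hence everywhere. -/
theorem TilesWeighted.tilesPeriodically {P : ℤ[X]} (h : TilesWeighted P) (hP : P ∈ nonnegPoly)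
    (h0 : P.coeff 0 = 1) (hlead : P.Monic) : TilesPeriodically P := by
  obtain ⟨β, hβ, h⟩ := h
  have hle := le_one_of_act_eq_one hP h0 hβ h
  obtain ⟨t, t', hne, heq⟩ := Finite.exists_ne_map_eq_of_infinite
    (fun (t : ℕ) (i : Fin P.natDegree) => decide (β (t + (i : ℕ)) = 1))
  wlog hlt : t < t' generalizing t t'
  · exact this t' t hne.symm heq.symm (by omega)
  refine ⟨t' - t, β, by omega, ?_, hβ, h⟩
  have key : ((fun x => β (x + (t' - t : ℕ))) - β) = 0 := by
    refine eq_zero_of_act_eq_zero h0 hlead (t := t) ?_ ?_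
    · rw [act_sub_right, h]
      funext x
      have := congrFun h (x + (t' - t : ℕ))
      rw [act_apply] at this
      simp only [Pi.sub_apply, act_apply, Pi.one_apply, Pi.zero_apply] at this ⊢
      rw [← this, sub_eq_zero]
      refine Finset.sum_congr rfl fun a _ => ?_
      congr 2
      ring
    · intro y hy hy'
      have := congrFun heq ⟨(y - t).toNat, by omega⟩
      have e1 : (t : ℤ) + ((y - t).toNat : ℤ) = y := by omega
      have e2 : (t' : ℤ) + ((y - t).toNat : ℤ) = y + (t' - t : ℕ) := by omega
      simp only [e1, e2, decide_eq_decide] at this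
      have a1 := hle y
      have a2 := hle (y + (t' - t : ℕ))
      have a3 : 0 ≤ β y := hβ y
      have a4 : 0 ≤ β (y + (t' - t : ℕ)) := hβ _
      simp only [Pi.sub_apply]
      omega
  intro x
  have := congrFun key x
  simpa [sub_eq_zero] using this

/-! ### Dilating a factor of a tiling -/

theorem exists_expand_eq_pow_add (k : ℕ) (hk : k.Prime) (Q : ℤ[X]) :
    ∃ W : ℤ[X], expand ℤ k Q = Q ^ k + C (k : ℤ) * W := by
  have := Fact.mk hk
  have : C (k : ℤ) ∣ expand ℤ k Q - Q ^ k := by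
    rw [C_dvd_iff_dvd_coeff]
    intro a
    rw [← ZMod.intCast_zmod_eq_zero_iff_dvd]
    have : (expand ℤ k Q - Q ^ k).map (Int.castRingHom (ZMod k)) = 0 := by
      rw [Polynomial.map_sub, Polynomial.map_pow, map_expand, ZMod.expand_card, sub_self]
    simpa only [coeff_map, eq_intCast, coeff_zero] using congrArg (fun q => coeff q a) this
  obtain ⟨W, hW⟩ := this
  exact ⟨W, by rw [← hW]; ring⟩

/-- Dilating a factor of a tiling by a prime that does not divide its size yields a tiling. -/
theorem TilesPeriodically.expand_prime {Q R : ℤ[X]} (h : TilesPeriodically (Q * R))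
    (hQ : Q ∈ nonnegPoly) (hR : R ∈ nonnegPoly) {k : ℕ} (hk : k.Prime)
    (hkQ : ¬ (k : ℤ) ∣ Q.eval 1) : TilesPeriodically (expand ℤ k Q * R) := by
  have := Fact.mk hk
  obtain ⟨M, β, hM, hper, hβ, h⟩ := h
  refine ⟨M, β, hM, hper, hβ, ?_⟩
  rw [act_mul] at h ⊢
  set γ := act R β
  have hγ : 0 ≤ γ := act_nonneg hR hβ
  have hγper : Function.Periodic γ M := act_periodic hper R
  have hexp : expand ℤ k Q ∈ nonnegPoly := by
    intro a
    rw [coeff_expand hk.pos]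
    split_ifs
    · exact hQ _
    · rfl
  have hone : ∀ x, 1 ≤ act (expand ℤ k Q) γ x := by
    intro x
    obtain ⟨W, hW⟩ := exists_expand_eq_pow_add k hk Q
    -- Modulo `k`, `Q(x^k)` is `Q^k`; one `Q` turns `γ` into 1, and the other `k - 1` multiply 1 by
    -- `Q(1)`. Fermat's little theorem then gives the residue 1, so the nonnegative value cannot be
    -- 0.
    have h1 : act (expand ℤ k Q) γ x = Q.eval 1 ^ (k - 1) + k * act W γ x := by
      rw [hW, act_add, act_C_mul, ← Nat.sub_add_cancel hk.one_le, pow_succ, act_mul, h,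
        act_one_right]
      simp
    have h2 : ((act (expand ℤ k Q) γ x : ℤ) : ZMod k) = 1 := by
      rw [h1]
      push_cast
      rw [ZMod.pow_card_sub_one_eq_one, CharP.cast_eq_zero, zero_mul, add_zero]
      rwa [Ne, ZMod.intCast_zmod_eq_zero_iff_dvd]
    have h3 : 0 ≤ act (expand ℤ k Q) γ x := act_nonneg hexp hγ x
    have h4 : act (expand ℤ k Q) γ x ≠ 0 := by
      intro h0
      rw [h0] at h2
      simp at h2
    omega
  -- Dilation does not change `Q(1)`, so the sum over a period is the same as for `Q γ = 1`. Values
  -- at least 1 with average 1 are all equal to 1.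
  have hsum : ∑ x ∈ Finset.range M, (1 : ℤ) = ∑ x ∈ Finset.range M, act (expand ℤ k Q) γ x := by
    rw [sum_range_act hγper, expand_eval, one_pow, ← sum_range_act hγper, h]
    simp
  have hmem := (Finset.sum_eq_sum_iff_of_le fun (x : ℕ) _ => hone x).1 hsum
  have hper' := act_periodic hγper (expand ℤ k Q)
  funext x
  have hx0 : 0 ≤ x % (M : ℤ) := Int.emod_nonneg _ (by omega)
  have hx1 : x % (M : ℤ) < M := Int.emod_lt_of_pos _ (by omega)
  have e := hmem (x % (M : ℤ)).toNat (by rw [Finset.mem_range]; omega)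
  rw [Int.toNat_of_nonneg hx0] at e
  have e2 := hper'.int_mul (x / (M : ℤ)) (x % (M : ℤ))
  have e3 : x % (M : ℤ) + ((x / (M : ℤ) : ℤ) : ℤ) * (M : ℤ) = x := by
    rw [mul_comm]; exact Int.emod_add_mul_ediv x M
  rw [Int.cast_id, e3] at e2
  rw [e2, ← e]
  rfl

theorem expand_progressionPoly (m n k : ℕ) :
    expand ℤ k (progressionPoly m n) = progressionPoly (k * m) n := by
  simp [progressionPoly, ← pow_mul, mul_assoc]

theorem eval_one_progressionPoly (m n : ℕ) : (progressionPoly m n).eval 1 = n := by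
  simp [progressionPoly, eval_finsetSum]

theorem TilesPeriodically.dilate {m n k : ℕ} {R : ℤ[X]} (hR : R ∈ nonnegPoly)
    (hk : k ≠ 0) (hkn : k.Coprime n) (h : TilesPeriodically (progressionPoly m n * R)) :
    TilesPeriodically (progressionPoly (k * m) n * R) := by
  induction k using Nat.recOnMul generalizing m with
  | zero => exact absurd rfl hk
  | one => simpa using h
  | prime q hq =>
    rw [← expand_progressionPoly]
    refine h.expand_prime (progressionPoly_mem_nonnegPoly _ _) hR hq ?_
    rw [eval_one_progressionPoly, Int.natCast_dvd_natCast]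
    exact (Nat.Prime.coprime_iff_not_dvd hq).1 hkn
  | mul a b iha ihb =>
    rw [mul_assoc]
    exact iha (left_ne_zero_of_mul hk) (Nat.Coprime.coprime_mul_right hkn)
      (ihb (right_ne_zero_of_mul hk) (Nat.Coprime.coprime_mul_left hkn) h)

theorem TilesPeriodically.dilate_prod {ι : Type*} (S : Finset ι) {m n k : ι → ℕ}
    {R : ℤ[X]} (hR : R ∈ nonnegPoly) (hk : ∀ i ∈ S, k i ≠ 0)
    (hkn : ∀ i ∈ S, (k i).Coprime (n i))
    (h : TilesPeriodically ((∏ i ∈ S, progressionPoly (m i) (n i)) * R)) :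
    TilesPeriodically ((∏ i ∈ S, progressionPoly (k i * m i) (n i)) * R) := by
  classical
  induction S using Finset.induction_on generalizing R with
  | empty => simpa using h
  | insert i S hi ih =>
    rw [Finset.prod_insert hi, mul_assoc]
    refine TilesPeriodically.dilate ?_ (hk i (Finset.mem_insert_self i S))
      (hkn i (Finset.mem_insert_self i S)) ?_
    · exact mul_mem (prod_mem fun _ _ => progressionPoly_mem_nonnegPoly _ _) hR
    · rw [mul_left_comm]
      refine ih (mul_mem (progressionPoly_mem_nonnegPoly _ _) hR)
        (fun j hj => hk j (Finset.mem_insert_of_mem hj))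
        (fun j hj => hkn j (Finset.mem_insert_of_mem hj)) ?_
      rwa [Finset.prod_insert hi, mul_assoc, mul_left_comm] at h

/-! ### Linear relations obstruct tilings -/

theorem TilesPeriodically.injOn_index {ι : Type*} [Fintype ι] [DecidableEq ι] {l n : ι → ℕ}
    (h : TilesPeriodically (∏ i, progressionPoly (l i) (n i))) {f g : ι → ℕ}
    (hf : ∀ i, f i < n i) (hg : ∀ i, g i < n i) (hfg : ∑ i, l i * f i = ∑ i, l i * g i) :
    f = g := by
  obtain ⟨M, β, hM, hper, hβ, h⟩ := h
  by_contra hne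
  obtain ⟨y, hy⟩ : ∃ y, 0 < β y := by
    by_contra! hcon
    have : β = 0 := le_antisymm hcon hβ
    rw [this] at h
    simpa [act] using congrFun h 0
  -- At this point both `f` and `g` contribute `β y > 0`, so the total would be at least 2.
  have h1 := congrFun h (y + ∑ i, (l i * f i : ℕ))
  simp only [progressionPoly] at h1
  rw [Finset.prod_univ_sum, act_sum] at h1
  simp only [Finset.prod_pow_eq_pow_sum, act_X_pow] at h1
  have h2 : ∑ x ∈ {f, g}, β (y + ∑ i, (l i * f i : ℕ) - (∑ i, l i * x i : ℕ)) ≤ 1 := by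
    rw [Pi.one_apply] at h1
    rw [← h1]
    refine Finset.sum_le_sum_of_subset_of_nonneg ?_ fun _ _ _ => hβ _
    intro x hx
    rw [Finset.mem_insert, Finset.mem_singleton] at hx
    rcases hx with rfl | rfl <;> simpa
  rw [Finset.sum_pair hne, ← hfg] at h2
  push_cast at h2
  rw [add_sub_cancel_right] at h2
  omega

/-- The steps of the prime factors of a tiling satisfy no linear relation in which the
coefficients are units modulo the respective primes. -/
theorem TilesPeriodically.false_of_relation {ι : Type*} [Fintype ι] [Nonempty ι] {t p : ι → ℕ}
    {R : ℤ[X]} (hR : R ∈ nonnegPoly) (hp : ∀ i, (p i).Prime)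
    (h : TilesPeriodically ((∏ i, progressionPoly (t i) (p i)) * R)) (c : ι → ℤ)
    (hc : ∀ i, ¬ (p i : ℤ) ∣ c i) (hct : ∑ i, c i * t i = 0) : False := by
  classical
  have hc0 : ∀ i, c i ≠ 0 := fun i h0 => hc i (h0 ▸ dvd_zero _)
  -- After dilation by `|c i|` the relation equates the sum of the steps with `c i > 0` and the sum
  -- of the others: two complementary 0-1 index vectors represent the same element.
  have h1 := (TilesPeriodically.dilate_prod Finset.univ (k := fun i => (c i).natAbs) hR
    (fun i _ => Int.natAbs_ne_zero.2 (hc0 i))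
    (fun i _ => (((hp i).coprime_iff_not_dvd).2
      (fun hd => hc i (Int.natCast_dvd.2 hd))).symm) h).of_mul hR
  have h2 := h1.injOn_index (f := fun i => if 0 < c i then 1 else 0)
    (g := fun i => if 0 < c i then 0 else 1)
    (fun i => by have := (hp i).one_lt; split_ifs <;> omega)
    (fun i => by have := (hp i).one_lt; split_ifs <;> omega) ?_
  · obtain ⟨i⟩ := ‹Nonempty ι›
    have := congrFun h2 i
    by_cases h : 0 < c i <;> simp [h] at this
  · zify
    rw [← sub_eq_zero, ← Finset.sum_sub_distrib]
    refine Eq.trans (Finset.sum_congr rfl fun i _ => ?_) hct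
    by_cases h : 0 < c i
    · simp [h, abs_of_pos h]
    · simp [h, abs_of_nonpos (not_lt.1 h)]

/-! ### Cyclotomic divisors and prime power layers -/

theorem progressionPoly_mul_X_pow_sub_one (m n : ℕ) :
    progressionPoly m n * (X ^ m - 1) = X ^ (m * n) - 1 := by
  simp_rw [progressionPoly, pow_mul]
  exact geom_sum_mul _ _

theorem progressionPoly_mul {m : ℕ} (hm : 0 < m) (a b : ℕ) :
    progressionPoly m (a * b) = progressionPoly m a * progressionPoly (m * a) b := by
  refine mul_right_cancel₀ (monic_X_pow_sub_C (1 : ℤ) hm.ne').ne_zero ?_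
  rw [C_1, progressionPoly_mul_X_pow_sub_one, mul_right_comm, progressionPoly_mul_X_pow_sub_one,
    mul_comm (X ^ (m * a) - 1), progressionPoly_mul_X_pow_sub_one, mul_assoc]

theorem progressionPoly_eq_prod_cyclotomic {m n : ℕ} (hm : 0 < m) (hn : 0 < n) :
    progressionPoly m n = ∏ d ∈ (m * n).divisors \ m.divisors, cyclotomic d ℤ := by
  have h := progressionPoly_mul_X_pow_sub_one m n
  rw [← prod_cyclotomic_eq_X_pow_sub_one (Nat.mul_pos hm hn),
    ← Finset.prod_sdiff (Nat.divisors_subset_of_dvd (Nat.mul_pos hm hn).ne' (dvd_mul_right m n)),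
    prod_cyclotomic_eq_X_pow_sub_one hm] at h
  exact mul_right_cancel₀ (monic_X_pow_sub_C (1 : ℤ) hm.ne').ne_zero h

theorem progressionPoly_monic {m n : ℕ} (hm : 0 < m) (hn : 0 < n) :
    (progressionPoly m n).Monic := by
  rw [progressionPoly_eq_prod_cyclotomic hm hn]
  exact monic_prod_of_monic _ _ fun d _ => cyclotomic.monic d ℤ

theorem progressionPoly_coeff_zero {m n : ℕ} (hm : 0 < m) (hn : 0 < n) :
    (progressionPoly m n).coeff 0 = 1 := by
  rw [coeff_zero_eq_eval_zero, progressionPoly, eval_finsetSum, Finset.sum_eq_single 0]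
  · simp
  · intro j _ hj
    simp [hm.ne', hj]
  · simp [hn.ne']

theorem cyclotomic_dvd_progressionPoly_iff {m n s : ℕ} (hm : 0 < m) (hn : 0 < n) (hs : 0 < s) :
    cyclotomic s ℤ ∣ progressionPoly m n ↔ s ∣ m * n ∧ ¬ s ∣ m := by
  have key : cyclotomic s ℤ ∣ progressionPoly m n ↔
      s ∈ (m * n).divisors \ m.divisors := by
    rw [progressionPoly_eq_prod_cyclotomic hm hn]
    refine ⟨fun h => ?_, fun h => Finset.dvd_prod_of_mem _ h⟩
    obtain ⟨d, hd, hsd⟩ := ((cyclotomic.irreducible hs).prime.dvd_finsetProd_iff _).1 h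
    have hd0 : 0 < d := Nat.pos_of_mem_divisors (Finset.mem_sdiff.1 hd).1
    have hass := (cyclotomic.irreducible hs).associated_of_dvd (cyclotomic.irreducible hd0) hsd
    rwa [cyclotomic_injective (eq_of_monic_of_associated (cyclotomic.monic s ℤ)
      (cyclotomic.monic d ℤ) hass)]
  rw [key]
  simp [hm.ne', hn.ne']

theorem cyclotomic_dvd_progressionProd_iff {N : ℕ} {m n : Fin N → ℕ} (hm : ∀ i, 0 < m i)
    (hn : ∀ i, 0 < n i) {s : ℕ} (hs : 0 < s) :
    cyclotomic s ℤ ∣ progressionProd m n ↔ ∃ i, s ∣ m i * n i ∧ ¬ s ∣ m i := by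
  rw [progressionProd, (cyclotomic.irreducible hs).prime.dvd_finsetProd_iff]
  simp [cyclotomic_dvd_progressionPoly_iff (hm _) (hn _) hs]

/-- The prime powers `s` such that `Φ_s` divides `(x^(mn) - 1) / (x^m - 1)`. -/
def primePowerLayers (m n : ℕ) : Finset ℕ :=
  ((m * n).divisors \ m.divisors).filter IsPrimePow

theorem mem_primePowerLayers {m n : ℕ} (hm : 0 < m) (hn : 0 < n) {s : ℕ} :
    s ∈ primePowerLayers m n ↔ IsPrimePow s ∧ s ∣ m * n ∧ ¬ s ∣ m := by
  simp [primePowerLayers, hm.ne', hn.ne', and_comm]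

theorem eval_one_cyclotomic_of_not_isPrimePow {d : ℕ} (h1 : d ≠ 1) (h : ¬ IsPrimePow d) :
    (cyclotomic d ℤ).eval 1 = 1 := by
  refine eval_one_cyclotomic_not_prime_pow ?_
  intro p hp k hk
  rcases Nat.eq_zero_or_pos k with rfl | hk0
  · exact h1 (by simpa using hk.symm)
  · exact h (hk ▸ hp.isPrimePow.pow hk0.ne')

theorem two_le_eval_one_cyclotomic {s : ℕ} (hs : IsPrimePow s) :
    2 ≤ (cyclotomic s ℤ).eval 1 := by
  obtain ⟨p, k, hp, hk, rfl⟩ := (isPrimePow_nat_iff s).1 hs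
  have := Fact.mk hp
  obtain ⟨k, rfl⟩ := Nat.exists_eq_succ_of_ne_zero hk.ne'
  rw [eval_one_cyclotomic_prime_pow]
  exact_mod_cast hp.two_le

/-- A cyclotomic divisor whose index is not a prime power has value 1 at 1; the exceptional index 1
does not occur because it divides `m`. -/
theorem prod_primePowerLayers {m n : ℕ} (hm : 0 < m) (hn : 0 < n) :
    ∏ s ∈ primePowerLayers m n, (cyclotomic s ℤ).eval 1 = n := by
  rw [← eval_one_progressionPoly m n, progressionPoly_eq_prod_cyclotomic hm hn, eval_prod,
    primePowerLayers, Finset.prod_filter]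
  refine Finset.prod_congr rfl fun d hd => ?_
  split_ifs with h
  · rfl
  · refine (eval_one_cyclotomic_of_not_isPrimePow ?_ h).symm
    rintro rfl
    simp [hm.ne'] at hd

/-- At a prime `p ∣ n` both sides say `v_p(m) + v_p(n) ≤ v_p(m')`: the exponent on the left is the
top layer at `p`, and the minimum coming from the gcd cannot be `v_p(m')` since `v_p(n) > 0`, unless
it also equals `v_p(m)`. -/
theorem dvd_div_gcd_iff {m n m' : ℕ} (hm : 0 < m) (hn : 0 < n) (hm' : 0 < m') :
    n ∣ m' / Nat.gcd m m' ↔ ∀ s ∈ primePowerLayers m n, s ∣ m' := by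
  have hg : 0 < Nat.gcd m m' := Nat.gcd_pos_of_pos_left _ hm
  rw [Nat.dvd_div_iff_mul_dvd (Nat.gcd_dvd_right m m'), ← Nat.factorization_le_iff_dvd
    (Nat.mul_pos hg hn).ne' hm'.ne', Nat.factorization_mul hg.ne' hn.ne',
    Nat.factorization_gcd hm.ne' hm'.ne']
  constructor
  · intro h s hs
    obtain ⟨hs, h1, h2⟩ := (mem_primePowerLayers hm hn).1 hs
    obtain ⟨p, k, hp, hk, rfl⟩ := (isPrimePow_nat_iff s).1 hs
    have := h p
    rw [hp.pow_dvd_iff_le_factorization (Nat.mul_pos hm hn).ne',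
      Nat.factorization_mul hm.ne' hn.ne'] at h1
    rw [hp.pow_dvd_iff_le_factorization hm.ne'] at h2
    rw [hp.pow_dvd_iff_le_factorization hm'.ne']
    simp only [Finsupp.add_apply, Finsupp.inf_apply] at this h1
    omega
  · intro h p
    by_cases hp : p.Prime
    · by_cases hpn : n.factorization p = 0
      · simp [hpn]
      have := h (p ^ (m.factorization p + n.factorization p)) ?_
      · rw [hp.pow_dvd_iff_le_factorization hm'.ne'] at this
        simp only [Finsupp.add_apply, Finsupp.inf_apply]
        omega
      · rw [mem_primePowerLayers hm hn, hp.pow_dvd_iff_le_factorization hm.ne',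
          hp.pow_dvd_iff_le_factorization (Nat.mul_pos hm hn).ne',
          Nat.factorization_mul hm.ne' hn.ne']
        refine ⟨hp.isPrimePow.pow (by omega), by simp, by omega⟩
    · simp [Nat.factorization_eq_zero_of_not_prime, hp]

theorem cyclotomicPrimePowers_progressionProd {N : ℕ} {m n : Fin N → ℕ} (hm : ∀ i, 0 < m i)
    (hn : ∀ i, 0 < n i) : cyclotomicPrimePowers (progressionProd m n) =
      (Finset.univ.biUnion fun i => primePowerLayers (m i) (n i) : Finset ℕ) := by
  ext s
  simp only [cyclotomicPrimePowers, Set.mem_ofPred_eq, Finset.coe_biUnion, Set.mem_iUnion,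
    Finset.mem_coe, mem_primePowerLayers (hm _) (hn _), Finset.mem_univ, exists_prop, true_and]
  constructor
  · rintro ⟨h1, h2⟩
    obtain ⟨i, hi⟩ := (cyclotomic_dvd_progressionProd_iff hm hn h1.pos).1 h2
    exact ⟨i, h1, hi⟩
  · rintro ⟨i, h1, hi⟩
    exact ⟨h1, (cyclotomic_dvd_progressionProd_iff hm hn h1.pos).2 ⟨i, hi⟩⟩

theorem mem_cyclotomicPrimePowers_progressionProd {N : ℕ} {m n : Fin N → ℕ} (hm : ∀ i, 0 < m i)
    (hn : ∀ i, 0 < n i) {s : ℕ} : s ∈ cyclotomicPrimePowers (progressionProd m n) ↔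
      ∃ i, s ∈ primePowerLayers (m i) (n i) := by
  simp [cyclotomicPrimePowers_progressionProd hm hn]

/-- (T1) says that the prime power cyclotomic divisors of the factors are all distinct. -/
theorem conditionT1_progressionProd_iff {N : ℕ} {m n : Fin N → ℕ} (hm : ∀ i, 0 < m i)
    (hn : ∀ i, 0 < n i) : ConditionT1 (progressionProd m n) ↔
      Pairwise fun i j => Disjoint (primePowerLayers (m i) (n i)) (primePowerLayers (m j) (n j)) := by
  have heval : (progressionProd m n).eval 1 =
      ∏ i, ∏ s ∈ primePowerLayers (m i) (n i), (cyclotomic s ℤ).eval 1 := by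
    simp only [progressionProd, eval_prod, eval_one_progressionPoly,
      prod_primePowerLayers (hm _) (hn _)]
  rw [ConditionT1, heval, cyclotomicPrimePowers_progressionProd hm hn, finprod_mem_coe_finset]
  constructor
  · intro h i j hij
    rw [Finset.disjoint_left]
    intro s hsi hsj
    refine absurd h (ne_of_gt ?_)
    set U := Finset.univ.biUnion fun i => primePowerLayers (m i) (n i)
    -- Each layer is counted with the number of factors carrying it. As every value is at least 2, a
    -- single repetition makes the product strictly larger.
    have hcomm : ∏ i, ∏ s ∈ primePowerLayers (m i) (n i), (cyclotomic s ℤ).eval 1 =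
        ∏ s ∈ U, (cyclotomic s ℤ).eval 1 ^
          (Finset.univ.filter fun i => s ∈ primePowerLayers (m i) (n i)).card := by
      simp_rw [← Finset.prod_const]
      refine Finset.prod_comm' fun i s => ?_
      simp only [Finset.mem_univ, true_and, Finset.mem_filter, U, Finset.mem_biUnion]
      exact ⟨fun h => ⟨h, i, h⟩, fun h => h.1⟩
    have hU : ∀ s ∈ U, 2 ≤ (cyclotomic s ℤ).eval 1 := by
      intro s hs
      obtain ⟨i, -, hi⟩ := Finset.mem_biUnion.1 hs
      exact two_le_eval_one_cyclotomic ((mem_primePowerLayers (hm i) (hn i)).1 hi).1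
    have hsU : s ∈ U := Finset.mem_biUnion.2 ⟨i, Finset.mem_univ i, hsi⟩
    rw [hcomm]
    refine Finset.prod_lt_prod (fun s hs => ?_) (fun s hs => ?_) ⟨s, hsU, ?_⟩
    · linarith [hU s hs]
    · refine le_self_pow₀ (by linarith [hU s hs]) (Finset.card_ne_zero.2 ?_)
      obtain ⟨i, -, hi⟩ := Finset.mem_biUnion.1 hs
      exact ⟨i, by simpa using hi⟩
    · refine lt_self_pow₀ (by linarith [hU s hsU]) (Finset.one_lt_card.2 ?_)
      exact ⟨i, by simpa using hsi, j, by simpa using hsj, hij⟩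
  · intro h
    rw [Finset.prod_biUnion]
    exact fun i _ j _ hij => h hij

/-! ### Orderings obtained by peeling off one factor at a time -/

theorem divisibilityTower_iff {N : ℕ} {m n : Fin N → ℕ} : DivisibilityTower m n ↔
    ∀ i j, i < j → n i ∣ m j / Nat.gcd (m i) (m j) := by
  simp [DivisibilityTower, Finset.dvd_gcd_iff]

theorem progressionProd_comp_perm {N : ℕ} (m n : Fin N → ℕ) (σ : Equiv.Perm (Fin N)) :
    progressionProd (m ∘ σ) (n ∘ σ) = progressionProd m n :=
  Equiv.prod_comp σ fun i => progressionPoly (m i) (n i)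

theorem exists_list_of_forall_exists_first {α : Type*} [DecidableEq α] (r : α → α → Prop)
    (G : Finset α → Prop) (h : ∀ S, G S → S.Nonempty →
      ∃ i ∈ S, (∀ j ∈ S, j ≠ i → r i j) ∧ G (S.erase i)) (S : Finset α) (hS : G S) :
    ∃ l : List α, l.Nodup ∧ (∀ x, x ∈ l ↔ x ∈ S) ∧ l.Pairwise r := by
  induction S using Finset.strongInduction with
  | H S ih =>
    rcases S.eq_empty_or_nonempty with rfl | hne
    · exact ⟨[], by simp⟩
    obtain ⟨i, hi, hr, hG⟩ := h S hS hne
    obtain ⟨l, h1, h2, h3⟩ := ih _ (Finset.erase_ssubset hi) hG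
    refine ⟨i :: l, List.nodup_cons.2 ⟨by simp [h2], h1⟩, fun x => ?_, List.pairwise_cons.2
      ⟨fun j hj => ?_, h3⟩⟩
    · rw [List.mem_cons, h2, Finset.mem_erase]
      by_cases hx : x = i <;> simp [hx, hi]
    · rw [h2, Finset.mem_erase] at hj
      exact hr j hj.2 hj.1

theorem exists_perm_of_forall_exists_first {N : ℕ} (r : Fin N → Fin N → Prop)
    (G : Finset (Fin N) → Prop) (h : ∀ S, G S → S.Nonempty →
      ∃ i ∈ S, (∀ j ∈ S, j ≠ i → r i j) ∧ G (S.erase i)) (hG : G Finset.univ) :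
    ∃ σ : Equiv.Perm (Fin N), ∀ i j, i < j → r (σ i) (σ j) := by
  obtain ⟨l, h1, h2, h3⟩ := exists_list_of_forall_exists_first r G h _ hG
  let e := List.Nodup.getEquivOfForallMemList l h1 fun x => (h2 x).2 (Finset.mem_univ x)
  have hlen : N = l.length := by simpa using (Fintype.card_congr e).symm
  refine ⟨(finCongr hlen).trans e, fun i j hij => ?_⟩
  exact List.pairwise_iff_get.1 h3 _ _ (by simpa using hij)

/-! ### The tower implies (T1) and (T2) -/

theorem conditionT2_of_divisibilityTower {N : ℕ} {m n : Fin N → ℕ} (hm : ∀ i, 0 < m i)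
    (hn : ∀ i, 0 < n i) (h : DivisibilityTower m n) : ConditionT2 (progressionProd m n) := by
  rw [divisibilityTower_iff] at h
  intro F α hF hprime hmem
  have hmem' : ∀ p : F, ∃ i, (p : ℕ) ^ α p ∈ primePowerLayers (m i) (n i) := fun p =>
    (mem_cyclotomicPrimePowers_progressionProd hm hn).1 (hmem p p.2)
  choose f hf using hmem'
  have hpos : 0 < ∏ p ∈ F, p ^ α p := Finset.prod_pos fun p hp => pow_pos (hprime p hp).pos _
  have : Nonempty F := hF.to_subtype
  -- The last factor involved is the witness: layers of earlier factors already divide its `m`, its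
  -- own layers divide `m n`, and the layer at `q` does not divide `m`.
  obtain ⟨q, hq⟩ := Finite.exists_max f
  refine (cyclotomic_dvd_progressionProd_iff hm hn hpos).2 ⟨f q, ?_, ?_⟩
  · refine Finset.prod_dvd_of_isRelPrime ?_ fun p hp => ?_
    · intro p hp p' hp' hne
      exact Nat.coprime_iff_isRelPrime.1
        (Nat.Coprime.pow _ _ ((Nat.coprime_primes (hprime p hp) (hprime p' hp')).2 hne))
    · rcases (hq ⟨p, hp⟩).lt_or_eq with hlt | heq
      · exact ((dvd_div_gcd_iff (hm _) (hn _) (hm _)).1 (h _ _ hlt) _ (hf ⟨p, hp⟩)).mul_right _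
      · rw [← heq]
        exact ((mem_primePowerLayers (hm _) (hn _)).1 (hf ⟨p, hp⟩)).2.1
  · intro hd
    exact ((mem_primePowerLayers (hm _) (hn _)).1 (hf q)).2.2
      ((Finset.dvd_prod_of_mem (fun p => p ^ α p) q.2).trans hd)

theorem conditionT1_of_divisibilityTower {N : ℕ} {m n : Fin N → ℕ} (hm : ∀ i, 0 < m i)
    (hn : ∀ i, 0 < n i) (h : DivisibilityTower m n) : ConditionT1 (progressionProd m n) := by
  rw [divisibilityTower_iff] at h
  rw [conditionT1_progressionProd_iff hm hn]
  have key : ∀ i j, i < j →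
      Disjoint (primePowerLayers (m i) (n i)) (primePowerLayers (m j) (n j)) := by
    intro i j hij
    rw [Finset.disjoint_left]
    intro s hsi hsj
    exact ((mem_primePowerLayers (hm _) (hn _)).1 hsj).2.2
      ((dvd_div_gcd_iff (hm _) (hn _) (hm _)).1 (h i j hij) s hsi)
  intro i j hij
  rcases lt_or_gt_of_ne hij with hlt | hlt
  · exact key i j hlt
  · exact (key j i hlt).symm

/-! ### (T1) and (T2) imply the tower -/

/-- The combinatorial content of (T2), restricted to the factors with index in `S`. -/
def LayersCompatible {ι : Type*} (m n : ι → ℕ) (S : Finset ι) : Prop :=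
  ∀ (F : Finset ℕ) (α : ℕ → ℕ), F.Nonempty →
    (∀ p ∈ F, p.Prime ∧ ∃ i ∈ S, p ^ α p ∈ primePowerLayers (m i) (n i)) →
      ∃ i ∈ S, ∏ p ∈ F, p ^ α p ∣ m i * n i ∧ ¬ ∏ p ∈ F, p ^ α p ∣ m i

/-- All layers of the other factors divide `m i`, and so do their products over distinct primes;
thus `i` is never the witness for such a product. -/
theorem LayersCompatible.erase {ι : Type*} [DecidableEq ι] {m n : ι → ℕ} (hm : ∀ i, 0 < m i)
    (hn : ∀ i, 0 < n i) {S : Finset ι} (h : LayersCompatible m n S) {i : ι}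
    (hi : ∀ j ∈ S, j ≠ i → n j ∣ m i / Nat.gcd (m j) (m i)) :
    LayersCompatible m n (S.erase i) := by
  intro F α hF hmem
  obtain ⟨k, hkS, hk⟩ := h F α hF fun p hp =>
    ⟨(hmem p hp).1, (hmem p hp).2.imp fun j hj => ⟨Finset.mem_of_mem_erase hj.1, hj.2⟩⟩
  refine ⟨k, Finset.mem_erase.2 ⟨?_, hkS⟩, hk⟩
  rintro rfl
  refine hk.2 (Finset.prod_dvd_of_isRelPrime ?_ fun p hp => ?_)
  · intro p hp p' hp' hne
    exact Nat.coprime_iff_isRelPrime.1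
      (Nat.Coprime.pow _ _ ((Nat.coprime_primes (hmem p hp).1 (hmem p' hp').1).2 hne))
  · obtain ⟨-, j, hj, hpj⟩ := hmem p hp
    rw [Finset.mem_erase] at hj
    exact (dvd_div_gcd_iff (hm _) (hn _) (hm _)).1 (hi j hj.2 hj.1) _ hpj

/-- Compatibility, applied to the top layer of each prime, gives a factor `i` whose `m i * n i` is
divisible by every layer. A layer of another factor not dividing `m i` would then be a layer of `i`,
against disjointness. -/
theorem LayersCompatible.exists_last {ι : Type*} {m n : ι → ℕ} (hm : ∀ i, 0 < m i)
    (hn : ∀ i, 0 < n i) (hdisj : Pairwise fun i j =>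
      Disjoint (primePowerLayers (m i) (n i)) (primePowerLayers (m j) (n j)))
    {S : Finset ι} (hS : S.Nonempty) (h : LayersCompatible m n S) :
    ∃ i ∈ S, ∀ j ∈ S, j ≠ i → n j ∣ m i / Nat.gcd (m j) (m i) := by
  classical
  have hmax : ∀ p : ℕ, ∃ a : ℕ, (∃ i ∈ S, ∃ k, p ^ k ∈ primePowerLayers (m i) (n i)) → p.Prime →
      (∃ i ∈ S, p ^ a ∈ primePowerLayers (m i) (n i)) ∧
        ∀ i ∈ S, ∀ k, p ^ k ∈ primePowerLayers (m i) (n i) → k ≤ a := by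
    intro p
    by_cases hp : (∃ i ∈ S, ∃ k, p ^ k ∈ primePowerLayers (m i) (n i)) ∧ p.Prime
    swap
    · exact ⟨0, fun h1 h2 => absurd ⟨h1, h2⟩ hp⟩
    obtain ⟨⟨i, hi, k, hk⟩, hp⟩ := hp
    let V : Set ℕ := {k | ∃ i ∈ S, p ^ k ∈ primePowerLayers (m i) (n i)}
    have hV : V.Finite := by
      refine (Finset.finite_toSet (S.biUnion fun i => primePowerLayers (m i) (n i))).preimage
        (f := fun k => p ^ k) (Nat.pow_right_injective hp.two_le).injOn |>.subset ?_
      rintro k ⟨i, hi, hk⟩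
      simpa using ⟨i, hi, hk⟩
    obtain ⟨a, ha, hamax⟩ := hV.exists_maximal ⟨k, i, hi, hk⟩
    refine ⟨a, fun _ _ => ⟨ha, fun i hi k hk => ?_⟩⟩
    by_contra! hlt
    exact absurd (hamax (y := k) ⟨i, hi, hk⟩ hlt.le) (not_le.2 hlt)
  choose α hα using hmax
  let F : Finset ℕ := (S.biUnion fun i => primePowerLayers (m i) (n i)).image Nat.minFac
  have hFmem : ∀ i ∈ S, ∀ p k, p.Prime → p ^ k ∈ primePowerLayers (m i) (n i) → p ∈ F := by
    intro i hi p k hp hk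
    have hk0 : k ≠ 0 := by
      rintro rfl
      simpa using ((mem_primePowerLayers (hm i) (hn i)).1 hk).2.2
    refine Finset.mem_image.2 ⟨p ^ k, Finset.mem_biUnion.2 ⟨i, hi, hk⟩, ?_⟩
    exact hp.pow_minFac hk0
  have hF : ∀ p ∈ F, p.Prime ∧ ∃ i ∈ S, ∃ k, p ^ k ∈ primePowerLayers (m i) (n i) := by
    intro p hp
    obtain ⟨s, hs, rfl⟩ := Finset.mem_image.1 hp
    obtain ⟨i, hi, hs⟩ := Finset.mem_biUnion.1 hs
    obtain ⟨q, k, hq, hk, rfl⟩ :=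
      (isPrimePow_nat_iff s).1 ((mem_primePowerLayers (hm i) (hn i)).1 hs).1
    rw [hq.pow_minFac hk.ne']
    exact ⟨hq, i, hi, k, hs⟩
  have hmain : ∃ i ∈ S, ∀ p ∈ F, p ^ α p ∣ m i * n i := by
    -- Without layers there is nothing to divide, and any factor can be last.
    rcases F.eq_empty_or_nonempty with hFe | hFne
    · obtain ⟨i, hi⟩ := hS
      exact ⟨i, hi, by simp [hFe]⟩
    · obtain ⟨i, hi, hd, -⟩ := h F α hFne fun p hp =>
        ⟨(hF p hp).1, (hα p (hF p hp).2 (hF p hp).1).1⟩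
      exact ⟨i, hi, fun p hp => (Finset.dvd_prod_of_mem (fun p => p ^ α p) hp).trans hd⟩
  obtain ⟨i, hi, hd⟩ := hmain
  refine ⟨i, hi, fun j hj hji => ?_⟩
  rw [dvd_div_gcd_iff (hm _) (hn _) (hm _)]
  intro s hs
  have hpp := ((mem_primePowerLayers (hm j) (hn j)).1 hs).1
  obtain ⟨p, k, hp, hk, rfl⟩ := (isPrimePow_nat_iff s).1 hpp
  have hle := (hα p ⟨j, hj, k, hs⟩ hp).2 j hj k hs
  by_contra hcon
  exact Finset.disjoint_left.1 (hdisj hji) hs ((mem_primePowerLayers (hm i) (hn i)).2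
    ⟨hpp, (pow_dvd_pow p hle).trans (hd p (hFmem j hj p k hp hs)), hcon⟩)

theorem exists_divisibilityTower_of_conditions {N : ℕ} {m n : Fin N → ℕ} (hm : ∀ i, 0 < m i)
    (hn : ∀ i, 0 < n i) (h1 : ConditionT1 (progressionProd m n))
    (h2 : ConditionT2 (progressionProd m n)) :
    ∃ σ : Equiv.Perm (Fin N), DivisibilityTower (m ∘ σ) (n ∘ σ) := by
  rw [conditionT1_progressionProd_iff hm hn] at h1
  obtain ⟨σ, hσ⟩ := exists_perm_of_forall_exists_first
    (fun i j => n j ∣ m i / Nat.gcd (m j) (m i)) (LayersCompatible m n)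
    (fun S hS hne => by
      obtain ⟨i, hi, hlast⟩ := hS.exists_last hm hn h1 hne
      exact ⟨i, hi, hlast, hS.erase hm hn hlast⟩) (by
      intro F α hF hmem
      have hpos : 0 < ∏ p ∈ F, p ^ α p :=
        Finset.prod_pos fun p hp => pow_pos (hmem p hp).1.pos _
      obtain ⟨i, hi⟩ := (cyclotomic_dvd_progressionProd_iff hm hn hpos).1
        (h2 F α hF (fun p hp => (hmem p hp).1) fun p hp =>
          (mem_cyclotomicPrimePowers_progressionProd hm hn).2
            ((hmem p hp).2.imp fun i hi => hi.2))
      exact ⟨i, Finset.mem_univ i, hi⟩)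
  -- The peeling starts from the last factor, so the order is reversed.
  refine ⟨Fin.revPerm.trans σ, divisibilityTower_iff.2 fun i j hij => ?_⟩
  exact hσ _ _ (Fin.rev_lt_rev.2 hij)

/-! ### Tiling implies the tower -/

theorem not_dvd_div_gcd {p a b : ℕ} (hp : p.Prime) (ha : 0 < a) (hb : 0 < b)
    (h : b.factorization p ≤ a.factorization p) : ¬ p ∣ b / Nat.gcd a b := by
  rw [hp.dvd_iff_one_le_factorization (Nat.div_pos (Nat.le_of_dvd hb (Nat.gcd_dvd_right a b))
    (Nat.gcd_pos_of_pos_left _ ha)).ne', Nat.factorization_div (Nat.gcd_dvd_right a b),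
    Nat.factorization_gcd ha.ne' hb.ne']
  simp only [Finsupp.coe_tsub, Pi.sub_apply, Finsupp.inf_apply]
  omega

theorem dvd_div_gcd_of_factorization_lt {p a b : ℕ} (hp : p.Prime) (ha : 0 < a) (hb : 0 < b)
    (h : b.factorization p < a.factorization p) : p ∣ a / Nat.gcd a b := by
  rw [hp.dvd_iff_one_le_factorization (Nat.div_pos (Nat.le_of_dvd ha (Nat.gcd_dvd_left a b))
    (Nat.gcd_pos_of_pos_left _ ha)).ne', Nat.factorization_div (Nat.gcd_dvd_left a b),
    Nat.factorization_gcd ha.ne' hb.ne']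
  simp only [Finsupp.coe_tsub, Pi.sub_apply, Finsupp.inf_apply]
  omega

theorem div_gcd_mul_eq (a b : ℕ) : b / Nat.gcd a b * a = a / Nat.gcd a b * b := by
  rw [Nat.div_mul_right_comm (Nat.gcd_dvd_right a b), Nat.div_mul_right_comm (Nat.gcd_dvd_left a b),
    mul_comm]

theorem dvd_of_mem_primePowerLayers {m n p k : ℕ} (hm : 0 < m) (hn : 0 < n) (hp : p.Prime)
    (h : p ^ k ∈ primePowerLayers m n) : p ∣ n := by
  obtain ⟨-, h1, h2⟩ := (mem_primePowerLayers hm hn).1 h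
  by_contra hpn
  exact h2 ((Nat.Coprime.pow_left k ((hp.coprime_iff_not_dvd).2 hpn)).dvd_of_dvd_mul_right h1)

/-- Each prime power layer `p ^ k` of a progression is carried by a direct factor of size `p`. -/
theorem exists_progressionPoly_factor {m n p k : ℕ} (hm : 0 < m) (hn : 0 < n) (hp : p.Prime)
    (h : p ^ k ∈ primePowerLayers m n) : ∃ t, 0 < t ∧ t.factorization p + 1 = k ∧
      ∃ R ∈ nonnegPoly, progressionPoly m n = progressionPoly t p * R := by
  obtain ⟨-, h1, h2⟩ := (mem_primePowerLayers hm hn).1 h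
  rw [hp.pow_dvd_iff_le_factorization (Nat.mul_pos hm hn).ne',
    Nat.factorization_mul hm.ne' hn.ne', Finsupp.add_apply] at h1
  rw [hp.pow_dvd_iff_le_factorization hm.ne'] at h2
  obtain ⟨u, rfl⟩ : ∃ u, k = m.factorization p + u + 1 :=
    ⟨k - m.factorization p - 1, by omega⟩
  obtain ⟨b, rfl⟩ : p ^ (u + 1) ∣ n := by
    rw [hp.pow_dvd_iff_le_factorization hn.ne']
    omega
  -- The progression splits along `n = p^u * p * b`; the middle piece has step `m * p^u`, of
  -- `p`-valuation `k - 1`.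
  refine ⟨m * p ^ u, Nat.mul_pos hm (pow_pos hp.pos u), ?_, progressionPoly m (p ^ u) *
    progressionPoly (m * p ^ u * p) b, mul_mem (progressionPoly_mem_nonnegPoly _ _)
      (progressionPoly_mem_nonnegPoly _ _), ?_⟩
  · rw [Nat.factorization_mul hm.ne' (pow_pos hp.pos u).ne', Finsupp.add_apply,
      hp.factorization_pow, Finsupp.single_eq_same]
  · rw [pow_succ, mul_assoc, progressionPoly_mul hm,
      progressionPoly_mul (Nat.mul_pos hm (pow_pos hp.pos u))]
    ring

/-- A common layer yields two factors of the same prime size `p` whose steps have equal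
`p`-valuation. Cross-multiplying the steps, divided by their gcd, gives a relation with coefficients
prime to `p`. -/
theorem TilesPeriodically.disjoint_layers {m n m' n' : ℕ} (hm : 0 < m) (hn : 0 < n)
    (hm' : 0 < m') (hn' : 0 < n') {R : ℤ[X]} (hR : R ∈ nonnegPoly)
    (h : TilesPeriodically (progressionPoly m n * (progressionPoly m' n' * R))) :
    Disjoint (primePowerLayers m n) (primePowerLayers m' n') := by
  rw [Finset.disjoint_left]
  intro s hs hs'
  obtain ⟨p, k, hp, -, rfl⟩ := (isPrimePow_nat_iff s).1 ((mem_primePowerLayers hm hn).1 hs).1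
  obtain ⟨t, ht, htk, Q, hQ, e⟩ := exists_progressionPoly_factor hm hn hp hs
  obtain ⟨t', ht', htk', Q', hQ', e'⟩ := exists_progressionPoly_factor hm' hn' hp hs'
  refine TilesPeriodically.false_of_relation (ι := Fin 2) (t := ![t, t']) (p := fun _ => p)
    (R := Q * (Q' * R)) (mul_mem hQ (mul_mem hQ' hR)) (fun _ => hp) ?_
    ![(t' / Nat.gcd t t' : ℕ), -(t / Nat.gcd t t' : ℕ)] ?_ ?_
  · rw [e, e'] at h
    rw [Fin.prod_univ_two]
    convert h using 1
    simp only [Matrix.cons_val_zero, Matrix.cons_val_one]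
    ring
  · intro i
    fin_cases i
    · simpa only [Fin.zero_eta, Matrix.cons_val_zero, Int.natCast_dvd_natCast] using
        not_dvd_div_gcd hp ht ht' (by omega)
    · have := not_dvd_div_gcd (a := t') (b := t) hp ht' ht (by omega)
      rw [Nat.gcd_comm] at this
      simpa only [Fin.mk_one, Matrix.cons_val_one, Matrix.cons_val_fin_one, dvd_neg,
        Int.natCast_dvd_natCast] using this
  · rw [Fin.sum_univ_two]
    simp only [Matrix.cons_val_zero, Matrix.cons_val_one]
    have := div_gcd_mul_eq t t'
    zify at this ⊢
    linarith

/-- Relations between pairs of the `t i` combine to one whose coefficients are units modulo the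
respective primes. -/
theorem exists_relation_of_pairs {ι : Type*} [Fintype ι] [DecidableEq ι] {t p : ι → ℕ}
    (hp : ∀ i, (p i).Prime) {j : ι → ι} (hj : ∀ i, j i ≠ i) {a b : ι → ℕ}
    (hab : ∀ i, a i * t i = b i * t (j i)) (ha : ∀ i, ¬ p i ∣ a i)
    (hb : ∀ i, p (j i) = p i → p i ∣ b i) :
    ∃ c : ι → ℤ, (∀ i, ¬ (p i : ℤ) ∣ c i) ∧ ∑ i, c i * t i = 0 := by
  -- The relation attached to `i` is weighted by the product of all primes occurring other than `p
  -- i`.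
  let τ : ι → ℕ := fun i => ∏ q ∈ (Finset.univ.image p).erase (p i), q
  let u : ι → ι → ℤ := fun i l =>
    (if l = i then (a i : ℤ) else 0) - (if l = j i then (b i : ℤ) else 0)
  refine ⟨fun l => ∑ i, (τ i : ℤ) * u i l, fun l hl => ?_, ?_⟩
  · dsimp only at hl
    rw [← Finset.add_sum_erase _ _ (Finset.mem_univ l)] at hl
    -- Modulo `p l`, the weight kills the relations attached to other primes, and `hb` kills those
    -- of the same prime that end at `l`. Only `τ l * a l`, a unit, remains.
    have hrest : (p l : ℤ) ∣ ∑ i ∈ Finset.univ.erase l, (τ i : ℤ) * u i l := by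
      refine Finset.dvd_sum fun i hi => ?_
      have hil : l ≠ i := (Finset.ne_of_mem_erase hi).symm
      by_cases hpp : p l = p i
      · refine Dvd.dvd.mul_left ?_ _
        by_cases hlj : l = j i
        · have h1 := hb i (by rw [← hlj, hpp])
          rw [← hpp] at h1
          simp only [u, if_neg hil, if_pos hlj, zero_sub, dvd_neg]
          exact_mod_cast h1
        · simp [u, hil, hlj]
      · refine Dvd.dvd.mul_right ?_ _
        rw [Int.natCast_dvd_natCast]
        exact Finset.dvd_prod_of_mem (fun q => q)
          (Finset.mem_erase.2 ⟨hpp, Finset.mem_image_of_mem p (Finset.mem_univ l)⟩)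
    have h1 := (dvd_add_left hrest).1 hl
    have h2 : u l l = a l := by simp [u, (hj l).symm]
    rw [h2, ← Nat.cast_mul, Int.natCast_dvd_natCast, (hp l).dvd_mul] at h1
    rcases h1 with h1 | h1
    · obtain ⟨q, hq, hlq⟩ := ((hp l).prime.dvd_finsetProd_iff _).1 h1
      obtain ⟨hne, hq⟩ := Finset.mem_erase.1 hq
      obtain ⟨i, -, rfl⟩ := Finset.mem_image.1 hq
      exact hne ((Nat.prime_dvd_prime_iff_eq (hp l) (hp i)).1 hlq).symm
    · exact ha l h1
  · simp_rw [Finset.sum_mul]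
    rw [Finset.sum_comm]
    refine Finset.sum_eq_zero fun i _ => ?_
    simp_rw [mul_assoc]
    rw [← Finset.mul_sum]
    have := hab i
    zify at this
    simp [u, sub_mul, Finset.sum_sub_distrib, this]

/-- Otherwise each `i` has a prime `p i ∣ n i` and some `j i ≠ i` with smaller valuation of `m n` at
`p i`. Splitting off from each factor a piece of size `p i` with step `m i * (n i / p i)`, the
pairwise relations between these steps combine into a forbidden one. -/
theorem TilesPeriodically.exists_first {ι : Type*} [Fintype ι] [Nonempty ι] {m n : ι → ℕ}
    (hm : ∀ i, 0 < m i) (hn : ∀ i, 0 < n i)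
    (h : TilesPeriodically (∏ i, progressionPoly (m i) (n i))) :
    ∃ i, ∀ j, j ≠ i → n i ∣ m j / Nat.gcd (m i) (m j) := by
  classical
  have hdisj : ∀ i j, j ≠ i →
      Disjoint (primePowerLayers (m i) (n i)) (primePowerLayers (m j) (n j)) := by
    intro i j hji
    rw [← Finset.mul_prod_erase _ _ (Finset.mem_univ i),
      ← Finset.mul_prod_erase _ _ (Finset.mem_erase.2 ⟨hji, Finset.mem_univ j⟩)] at h
    exact h.disjoint_layers (hm i) (hn i) (hm j) (hn j)
      (prod_mem fun _ _ => progressionPoly_mem_nonnegPoly _ _)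
  by_contra! hcon
  have hcon' : ∀ i, ∃ j, j ≠ i ∧ ∃ p, p.Prime ∧ p ∣ n i ∧
      (m j * n j).factorization p < (m i * n i).factorization p := by
    intro i
    obtain ⟨j, hji, hj⟩ := hcon i
    rw [dvd_div_gcd_iff (hm _) (hn _) (hm _)] at hj
    push Not at hj
    obtain ⟨s, hs, hsj⟩ := hj
    obtain ⟨hpp, h1, h2⟩ := (mem_primePowerLayers (hm i) (hn i)).1 hs
    obtain ⟨p, k, hp, -, rfl⟩ := (isPrimePow_nat_iff s).1 hpp
    refine ⟨j, hji, p, hp, dvd_of_mem_primePowerLayers (hm i) (hn i) hp hs, ?_⟩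
    rw [hp.pow_dvd_iff_le_factorization (Nat.mul_pos (hm i) (hn i)).ne'] at h1
    refine lt_of_lt_of_le ?_ h1
    -- A layer of `i` dividing `m j * n j` but not `m j` would be a layer of `j`.
    by_contra! hle
    rw [← hp.pow_dvd_iff_le_factorization (Nat.mul_pos (hm j) (hn j)).ne'] at hle
    exact Finset.disjoint_left.1 (hdisj i j hji) hs
      ((mem_primePowerLayers (hm j) (hn j)).2 ⟨hpp, hle, hsj⟩)
  choose j hj p hp hpn hlt using hcon'
  choose e he using hpn
  have hepos : ∀ i, 0 < e i := fun i =>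
    Nat.pos_of_ne_zero fun h0 => (hn i).ne' (by rw [he, h0, mul_zero])
  have htpos : ∀ i, 0 < m i * e i := fun i => Nat.mul_pos (hm i) (hepos i)
  have hmn : ∀ i, m i * n i = p i * (m i * e i) := fun i => by rw [he i]; ring
  have hfac : ∀ i q, (m i * n i).factorization q =
      (p i).factorization q + (m i * e i).factorization q := by
    intro i q
    rw [hmn i, Nat.factorization_mul (hp i).ne_zero (htpos i).ne', Finsupp.add_apply]
  -- The term from `p (j i)` matters when `p (j i) = p i`: the inequality of step valuations is then
  -- strict, which makes `b i` divisible by `p i`.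
  have hlt' : ∀ i, (m (j i) * e (j i)).factorization (p i) +
      (p (j i)).factorization (p i) ≤ (m i * e i).factorization (p i) := by
    intro i
    have h1 := hlt i
    rw [hfac, hfac, (hp i).factorization_self] at h1
    omega
  obtain ⟨c, hc, hct⟩ := exists_relation_of_pairs (t := fun i => m i * e i) hp hj
    (a := fun i => m (j i) * e (j i) / Nat.gcd (m i * e i) (m (j i) * e (j i)))
    (b := fun i => m i * e i / Nat.gcd (m i * e i) (m (j i) * e (j i)))
    (fun i => div_gcd_mul_eq _ _)
    (fun i => not_dvd_div_gcd (hp i) (htpos _) (htpos _) (by have := hlt' i; omega))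
    (fun i hpj => dvd_div_gcd_of_factorization_lt (hp i) (htpos _) (htpos _) (by
      have := hlt' i
      rw [hpj, (hp i).factorization_self] at this
      omega))
  refine TilesPeriodically.false_of_relation (t := fun i => m i * e i)
    (R := ∏ i, progressionPoly (m i) (e i))
    (prod_mem fun _ _ => progressionPoly_mem_nonnegPoly _ _) hp ?_ c hc hct
  rw [← Finset.prod_mul_distrib]
  convert h using 3 with i
  rw [he i, mul_comm (p i), progressionPoly_mul (hm i), mul_comm]

theorem exists_divisibilityTower_of_tilesPeriodically {N : ℕ} {m n : Fin N → ℕ}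
    (hm : ∀ i, 0 < m i) (hn : ∀ i, 0 < n i) (h : TilesPeriodically (progressionProd m n)) :
    ∃ σ : Equiv.Perm (Fin N), DivisibilityTower (m ∘ σ) (n ∘ σ) := by
  obtain ⟨σ, hσ⟩ := exists_perm_of_forall_exists_first
    (fun i j => n i ∣ m j / Nat.gcd (m i) (m j))
    (fun S => TilesPeriodically (∏ i ∈ S, progressionPoly (m i) (n i)))
    (fun S hS hne => by
      have : Nonempty S := hne.to_subtype
      have hS' := hS
      rw [← Finset.prod_coe_sort] at hS'
      obtain ⟨i, hi⟩ := hS'.exists_first (m := fun i : S => m i) (n := fun i : S => n i)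
        (fun i => hm i) (fun i => hn i)
      refine ⟨i, i.2, fun j hj hji => hi ⟨j, hj⟩ fun h => hji (congrArg Subtype.val h), ?_⟩
      rw [← Finset.prod_erase_mul _ _ i.2] at hS
      exact hS.of_mul (progressionPoly_mem_nonnegPoly _ _)) h
  exact ⟨σ, divisibilityTower_iff.2 hσ⟩

/-! ### The tower implies tiling -/

/-- Since `e` is invertible modulo `n`, the multiples `d * e * j` with `j < n` represent each class
of `dℤ` modulo `d * n` once. -/
theorem act_progressionPoly_indicator {e n d : ℕ} (hn : 0 < n) (hd : 0 < d) (hen : e.Coprime n) :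
    act (progressionPoly (d * e) n) (fun x => if ((d * n : ℕ) : ℤ) ∣ x then 1 else 0) =
      fun x => if (d : ℤ) ∣ x then 1 else 0 := by
  funext x
  rw [act_progressionPoly]
  by_cases hx : (d : ℤ) ∣ x
  · obtain ⟨y, rfl⟩ := hx
    have : NeZero n := ⟨hn.ne'⟩
    have hd' : (d : ℤ) ≠ 0 := by exact_mod_cast hd.ne'
    have hiff : ∀ j : ℕ, j < n → (((d * n : ℕ) : ℤ) ∣ d * y - (d * e : ℕ) * j ↔
        j = ((e : ZMod n)⁻¹ * y).val) := by
      intro j hj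
      have e1 : (d : ℤ) * y - (d * e : ℕ) * j = d * (y - e * j) := by push_cast; ring
      rw [e1, Nat.cast_mul, mul_dvd_mul_iff_left hd', ← ZMod.intCast_zmod_eq_zero_iff_dvd]
      push_cast
      have hu := ZMod.coe_mul_inv_eq_one e hen
      constructor
      · intro h
        rw [sub_eq_zero.1 h, ← mul_assoc, mul_comm (e : ZMod n)⁻¹, hu, one_mul,
          ZMod.val_natCast_of_lt hj]
      · rintro rfl
        rw [ZMod.natCast_zmod_val, ← mul_assoc, hu, one_mul, sub_self]
    rw [if_pos (dvd_mul_right _ _), Finset.sum_congr rfl fun j hj => by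
      rw [if_congr (hiff j (Finset.mem_range.1 hj)) rfl rfl]]
    rw [Finset.sum_ite_eq', if_pos (Finset.mem_range.2 (ZMod.val_lt _))]
  · rw [if_neg hx]
    refine Finset.sum_eq_zero fun j _ => if_neg fun h => hx ?_
    have h1 : (d : ℤ) ∣ x - (d * e : ℕ) * j :=
      (Int.natCast_dvd_natCast.2 (dvd_mul_right d n)).trans h
    have h2 : (d : ℤ) ∣ (d * e : ℕ) * j := by
      push_cast
      rw [mul_assoc]
      exact dvd_mul_right _ _
    exact (dvd_sub_left h2).1 h1

/-- The target `Dℤ`, rather than `ℤ`, is what the induction needs: with `d` the gcd of all `m i`,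
the tail must fill the multiples of `d * n 0`, and the first factor extends this to `dℤ`. -/
theorem exists_act_eq_indicator_of_divisibilityTower {N : ℕ} {m n : Fin N → ℕ}
    (hm : ∀ i, 0 < m i) (hn : ∀ i, 0 < n i) (h : DivisibilityTower m n) {D : ℕ} (hD : 0 < D)
    (hDm : ∀ i, D ∣ m i) :
    ∃ β : ℤ → ℤ, 0 ≤ β ∧ act (progressionProd m n) β = fun x => if (D : ℤ) ∣ x then 1 else 0 := by
  induction N generalizing D with
  | zero =>
    refine ⟨fun x => if (D : ℤ) ∣ x then 1 else 0, fun x => ?_, ?_⟩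
    · dsimp only
      split_ifs <;> simp
    · rw [progressionProd, Fin.prod_univ_zero, act_one]
  | succ N ih =>
    rw [divisibilityTower_iff] at h
    -- For an empty tail `G = 0`, and the gcd with `m 0` is `m 0` itself.
    set G := Finset.univ.gcd fun i : Fin N => m i.succ
    have hG : ∀ i : Fin N, G ∣ m i.succ := fun i => Finset.gcd_dvd (Finset.mem_univ i)
    have hd : 0 < Nat.gcd (m 0) G := Nat.gcd_pos_of_pos_left _ (hm 0)
    obtain ⟨e, he⟩ := Nat.gcd_dvd_left (m 0) G
    obtain ⟨f, hf⟩ : D ∣ Nat.gcd (m 0) G :=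
      Nat.dvd_gcd (hDm 0) (Finset.dvd_gcd fun i _ => hDm _)
    set d := Nat.gcd (m 0) G
    have hf0 : 0 < f := Nat.pos_of_ne_zero fun h0 => hd.ne' (by rw [hf, h0, mul_zero])
    have hdn : ∀ i : Fin N, d * n 0 ∣ m i.succ := by
      intro i
      have h1 := h 0 i.succ (Fin.succ_pos i)
      rw [Nat.dvd_div_iff_mul_dvd (Nat.gcd_dvd_right _ _)] at h1
      exact (Nat.mul_dvd_mul_right (Nat.dvd_gcd (Nat.gcd_dvd_left _ _)
        ((Nat.gcd_dvd_right _ _).trans (hG i))) _).trans h1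
    -- Both `m 0 = d * e` and every later `m i`, a multiple of `d * n 0`, are divisible by `d *
    -- gcd(e, n 0)`; as `d` is the gcd of them all, `gcd(e, n 0) = 1`.
    have hcop : e.Coprime (n 0) := by
      rw [Nat.coprime_iff_gcd_eq_one]
      have h1 : d * Nat.gcd e (n 0) ∣ d := by
        refine Nat.dvd_gcd ?_ (Finset.dvd_gcd fun i _ => ?_)
        · conv_rhs => rw [he]
          exact Nat.mul_dvd_mul_left _ (Nat.gcd_dvd_left _ _)
        · exact (Nat.mul_dvd_mul_left _ (Nat.gcd_dvd_right _ _)).trans (hdn i)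
      exact Nat.dvd_one.1 (Nat.dvd_of_mul_dvd_mul_left hd (by simpa using h1))
    obtain ⟨β, hβ, hact⟩ := ih (m := fun i => m i.succ) (n := fun i => n i.succ)
      (fun i => hm _) (fun i => hn _)
      (divisibilityTower_iff.2 fun i j hij => h _ _ (Fin.succ_lt_succ_iff.2 hij))
      (Nat.mul_pos hd (hn 0)) hdn
    -- The extra progression of step `D` and length `f = d / D` fills `dℤ` up to `Dℤ`.
    refine ⟨act (progressionPoly D f) β, act_nonneg (progressionPoly_mem_nonnegPoly _ _) hβ, ?_⟩
    have hprod : progressionProd m n = progressionPoly (d * e) (n 0) *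
        progressionProd (fun i => m i.succ) (fun i => n i.succ) := by
      rw [progressionProd, Fin.prod_univ_succ, ← he]
      rfl
    have h1 := act_progressionPoly_indicator (e := 1) hf0 hD (Nat.coprime_one_left f)
    rw [mul_one, ← hf] at h1
    rw [← act_mul, mul_comm, act_mul, hprod, act_mul, hact,
      act_progressionPoly_indicator (hn 0) hd hcop, h1]

/-! ### From weights to sets, and the equivalence -/

theorem progressionProd_mem_nonnegPoly {N : ℕ} (m n : Fin N → ℕ) :
    progressionProd m n ∈ nonnegPoly :=
  prod_mem fun _ _ => progressionPoly_mem_nonnegPoly _ _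

theorem progressionProd_coeff_zero {N : ℕ} {m n : Fin N → ℕ} (hm : ∀ i, 0 < m i)
    (hn : ∀ i, 0 < n i) : (progressionProd m n).coeff 0 = 1 := by
  rw [progressionProd, coeff_zero_prod]
  exact Finset.prod_eq_one fun i _ => progressionPoly_coeff_zero (hm i) (hn i)

theorem progressionProd_monic {N : ℕ} {m n : Fin N → ℕ} (hm : ∀ i, 0 < m i)
    (hn : ∀ i, 0 < n i) : (progressionProd m n).Monic :=
  monic_prod_of_monic _ _ fun i _ => progressionPoly_monic (hm i) (hn i)

theorem ConditionT.tilesWeighted {P : ℤ[X]} (h : ConditionT P) : TilesWeighted P := by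
  classical
  obtain ⟨A, rfl, B, hB⟩ := h
  refine ⟨fun x => if x ∈ B then 1 else 0, fun x => ?_, ?_⟩
  · dsimp only
    split_ifs <;> simp
  funext x
  rw [act_sum]
  simp only [act_X_pow, Pi.one_apply]
  obtain ⟨⟨⟨_, a, ha, rfl⟩, b⟩, hab, huniq⟩ := hB.existsUnique x
  dsimp only at hab
  rw [Finset.sum_eq_single a]
  · rw [if_pos]
    convert b.2
    rw [← hab]
    ring
  · intro a' ha' hne
    rw [if_neg]
    intro hmem
    have := huniq ⟨⟨(a' : ℤ), a', ha', rfl⟩, ⟨x - a', hmem⟩⟩ (by simp)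
    have h2 : (a' : ℤ) = a := congrArg (fun z => (z.1 : ℤ)) this
    exact hne (by exact_mod_cast h2)
  · intro h
    exact absurd ha h

/-- Constant coefficient 1 bounds the weight by 1, so it is the indicator of a set; evaluating at `y
+ a` for a point `y` of that set bounds each coefficient of `P` by 1. -/
theorem TilesWeighted.conditionT {P : ℤ[X]} (h : TilesWeighted P) (hP : P ∈ nonnegPoly)
    (h0 : P.coeff 0 = 1) : ConditionT P := by
  classical
  obtain ⟨β, hβ, h⟩ := h
  have hle := le_one_of_act_eq_one hP h0 hβ h
  have hβ01 : ∀ x, β x = if β x = 1 then 1 else 0 := by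
    intro x
    have h1 := hle x
    have h2 : 0 ≤ β x := hβ x
    split_ifs <;> omega
  obtain ⟨y, hy⟩ : ∃ y, β y = 1 := by
    by_contra! hcon
    have : β = 0 := by
      funext x
      rw [hβ01 x, if_neg (hcon x)]
      rfl
    rw [this] at h
    simpa [act] using congrFun h 0
  have hsum : P = ∑ a ∈ P.support, X ^ a := by
    conv_lhs => rw [P.as_sum_support_C_mul_X_pow]
    refine Finset.sum_congr rfl fun a ha => ?_
    have h1 := coeff_mul_le_act hP hβ a (y + a)
    rw [h, add_sub_cancel_right, hy, mul_one, Pi.one_apply] at h1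
    have h2 := hP a
    have h3 := mem_support_iff.1 ha
    rw [show P.coeff a = 1 by omega, C_1, one_mul]
  refine ⟨P.support, hsum, {x | β x = 1}, ?_⟩
  rw [AddSubgroup.isComplement_iff_existsUnique]
  intro x
  have hx := congrFun h x
  rw [hsum, act_sum] at hx
  simp only [act_X_pow, Pi.one_apply] at hx
  rw [Finset.sum_congr rfl fun a _ => hβ01 (x - (a : ℕ)), ← Finset.sum_filter,
    Finset.sum_const, nsmul_eq_mul, mul_one, Nat.cast_eq_one, Finset.card_eq_one] at hx
  obtain ⟨a, ha⟩ := hx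
  have ha' : a ∈ P.support.filter fun a : ℕ => β (x - a) = 1 := by rw [ha]; simp
  rw [Finset.mem_filter] at ha'
  refine ⟨⟨⟨a, a, ha'.1, rfl⟩, ⟨x - a, ha'.2⟩⟩, by simp, ?_⟩
  rintro ⟨⟨_, a', ha1, rfl⟩, ⟨b, hb⟩⟩ hab
  dsimp only at hab
  obtain rfl : b = x - a' := by rw [← hab]; ring
  have : a' ∈ P.support.filter fun a : ℕ => β (x - a) = 1 := Finset.mem_filter.2 ⟨ha1, hb⟩
  rw [ha, Finset.mem_singleton] at this
  subst this
  rfl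

theorem theorem4p3 {N : ℕ} (m n : Fin N → ℕ) (hm : ∀ i, 0 < m i) (hn : ∀ i, 0 < n i) :
    List.TFAE [
      ConditionT (progressionProd m n),
      ConditionT1 (progressionProd m n) ∧ ConditionT2 (progressionProd m n),
      ∃ σ : Equiv.Perm (Fin N), DivisibilityTower (m ∘ σ) (n ∘ σ)] := by
  tfae_have 1 → 3 := fun h =>
    exists_divisibilityTower_of_tilesPeriodically hm hn
      (h.tilesWeighted.tilesPeriodically (progressionProd_mem_nonnegPoly m n)
        (progressionProd_coeff_zero hm hn) (progressionProd_monic hm hn))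
  tfae_have 3 → 1 := by
    rintro ⟨σ, hσ⟩
    obtain ⟨β, hβ, h⟩ := exists_act_eq_indicator_of_divisibilityTower (m := m ∘ σ) (n := n ∘ σ)
      (fun i => hm (σ i))
      (fun i => hn (σ i)) hσ one_pos fun i => one_dvd _
    rw [progressionProd_comp_perm] at h
    refine TilesWeighted.conditionT ⟨β, hβ, ?_⟩ (progressionProd_mem_nonnegPoly m n)
      (progressionProd_coeff_zero hm hn)
    rw [h]
    funext x
    simp
  tfae_have 2 → 3 := fun h => exists_divisibilityTower_of_conditions hm hn h.1 h.2
  tfae_have 3 → 2 := by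
    rintro ⟨σ, hσ⟩
    rw [← progressionProd_comp_perm m n σ]
    exact ⟨conditionT1_of_divisibilityTower (fun i => hm (σ i)) (fun i => hn (σ i)) hσ,
      conditionT2_of_divisibilityTower (fun i => hm (σ i)) (fun i => hn (σ i)) hσ⟩
  tfae_finish
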